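/- **Setting.** Fix variable names $V$ and a finite set $N$ of nonterminals. Pure expressions are $e ::= x \mid e\,@\,e \mid \lambda x.e$; extended expressions may in addition contain nonterminals $A\in N$. A $\lambda$-regular grammar $\Gamma$ is a finite set of productions $A ::= e$ with $e$ extended. The derivation relation $e \Rightarrow^*_\Gamma t$ ($e$ extended, $t$ pure) is the smallest relation such that (i) if the nonterminal occurrences of $e$ are $X_1,\dots,X_k$ and $X_i\Rightarrow^*_\Gamma t_i$ for all $i$, then $e\Rightarrow^*_\Gamma e[t_1/X_1,\dots,t_k/X_k]$ (each occurrence is replaced independently, without renaming of bound variables); (ii) if $A::=e\in\Gamma$ and $e\Rightarrow^*_\Gamma t$, then $A\Rightarrow^*_\Gamma t$. Put $\mathrm{fv}(e)=\{x \mid \exists t.\ e\Rightarrow^*_\Gamma t,\ x\in \mathrm{fv}(t)\}$; an extended program is an extended expression $P$ all of whose derived pure expressions are closed. $\mathrm{subexps}(P)$ consists of all subterms of $P$, of all right-hand sides of productions of nonterminals occurring in them, and so on. **Exact semantics (pure).** States are $e:\rho$, where the environment $\rho$ is a map from a finite set of variables containing $\mathrm{fv}(e)$ to values, and values are states of the form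 $\lambda x.e:\rho$. Evaluation $\Downarrow$ and calls ${\to}={\to_r}\cup{\to_d}\cup{\to_c}$ are given by: $\lambda x.e:\rho\Downarrow\lambda x.e:\rho$; $x:\rho\Downarrow\rho(x)$; $e_1@e_2:\rho\to_r e_1:\rho$; if $e_1:\rho\Downarrow v_1$ then $e_1@e_2:\rho\to_d e_2:\rho$; if $e_1:\rho\Downarrow\lambda x.e_0:\rho_0$ and $e_2:\rho\Downarrow v_2$ then $e_1@e_2:\rho\to_c e_0:\rho_0[x\mapsto v_2]$; if $e_1@e_2:\rho\to_c s'$ and $s'\Downarrow v$ then $e_1@e_2:\rho\Downarrow v$. A closed pure $Q$ terminates if $Q:[\,]\Downarrow v$ for some $v$; an infinite call sequence of $Q$ is an infinite chain $Q:[\,]=s_0\to s_1\to\cdots$. An extended program $P$ with nonterminal occurrences $A_1,\dots,A_k$ is $\Gamma$-terminating if $P[t_1/A_1,\dots,t_k/A_k]$ terminates for all pure $t_i$ with $A_i\Rightarrow^*_\Gamma t_i$. **Size-change graphs** are sets of arcs $p\xrightarrow{r}q$ with $r\in\{=,\downarrow\}$, where $p,q$ are variables or the symbol $\epsilon$. In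 $G_1;G_2$ there is an arc $p\xrightarrow{\downarrow}q$ iff some path $p\xrightarrow{r}m\xrightarrow{s}q$ (first arc in $G_1$, second in $G_2$) has $r$ or $s$ equal to $\downarrow$, and an arc $p\xrightarrow{=}q$ iff there is such a path and all labels on all such paths are $=$. Put $\mathrm{id}^{=}_e=\{\epsilon\xrightarrow{=}\epsilon\}\cup\{y\xrightarrow{=}y\mid y\in\mathrm{fv}(e)\}$ and $\mathrm{id}^{\downarrow}_e=\{\epsilon\xrightarrow{\downarrow}\epsilon\}\cup\{y\xrightarrow{=}y\mid y\in\mathrm{fv}(e)\}$. With $y,z$ ranging over variables and $p,q$ over variables and $\epsilon$, $G^{-\epsilon/\lambda x.e_0}$ is $\{y\xrightarrow{r}z\mid y\xrightarrow{r}z\in G\}\cup\{\epsilon\xrightarrow{\downarrow}z\mid\epsilon\xrightarrow{r}z\in G\}$ if $x\in\mathrm{fv}(e_0)$, and $\{y\xrightarrow{r}z\mid y\xrightarrow{r}z\in G\}\cup\{\epsilon\xrightarrow{\downarrow}q\mid\epsilon\xrightarrow{r}q\in G\}\cup\{p\xrightarrow{\downarrow}\epsilon\mid p\xrightarrow{r}\epsilon\in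 G\}$ otherwise; $G^{\epsilon\mapsto x}=\{y\xrightarrow{r}x\mid y\xrightarrow{r}\epsilon\in G\}\cup\{\epsilon\xrightarrow{\downarrow}x\mid\epsilon\xrightarrow{r}\epsilon\in G\}$; and $G\cup_e G'$ consists of the arcs of $G\cup G'$ that end in $\mathrm{fv}(e)\cup\{\epsilon\}$. **Approximate extended semantics of $P$.** The judgements $e\Downarrow v,G$ and $e\to_k e',G$ ($k\in\{r,d,c,n\}$) on extended expressions are defined inductively by: - $\lambda x.e\Downarrow\lambda x.e,\ \mathrm{id}^{=}_{\lambda x.e}$; - if $e_1@e_2\in\mathrm{subexps}(P)$, $e_1\Downarrow\lambda x.e_0,G_1$ and $e_2\Downarrow v_2,G_2$, then $x\Downarrow v_2,\ \{x\xrightarrow{=}\epsilon\}\cup\{x\xrightarrow{\downarrow}y\mid y\in\mathrm{fv}(v_2)\}$; - $A\to_n e,\ \mathrm{id}^{=}_e$ for $A::=e\in\Gamma$; - $e_1@e_2\to_r e_1,\ \mathrm{id}^{\downarrow}_{e_1}$ and $e_1@e_2\to_d e_2,\ \mathrm{id}^{\downarrow}_{e_2}$; - if $e_1\Downarrow\lambda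 x.e_0,G_1$ and $e_2\Downarrow v_2,G_2$, then $e_1@e_2\to_c e_0,\ G_1^{-\epsilon/\lambda x.e_0}\cup_{e_0}G_2^{\epsilon\mapsto x}$; - if $e\to_k e',G'$ with $k\in\{c,n\}$ and $e'\Downarrow v,G$, then $e\Downarrow v,\ G';G$. An infinite call sequence of $P$ in this semantics consists of $P=e_0,e_1,\dots$ and graphs $G_0,G_1,\dots$ such that $e_i\to_k e_{i+1},G_i$ for some $k$, for every $i$. It has an infinitely descending thread if there are $j$ and arcs $a_i\xrightarrow{r_i}a_{i+1}\in G_i$ for all $i\ge j$ with $r_i={\downarrow}$ for infinitely many $i$. **Theorem.** Let $P$ be an extended program over a $\lambda$-regular grammar $\Gamma$. 1. If there is a closed pure expression $Q$ with $P\Rightarrow^*_\Gamma Q$ that has an infinite call sequence in the exact semantics, then $P$ has an infinite call sequence in the approximate extended semantics with no infinitely descending thread. 2. Consequently, if every infinite call sequence of $P$ in the approximate extended semantics has an infinitely descending thread, then $P$ is $\Gamma$-terminating. -/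

import Mathlib

namespace LambdaSCT

universe u v

/-! ## Pure and extended expressions, grammars -/

/-- `Exp`: pure lambda-expressions with variable names from `V`. -/
inductive PureExp (V : Type u) : Type u
  | var (x : V) : PureExp V
  | app (e₁ e₂ : PureExp V) : PureExp V
  | lam (x : V) (e : PureExp V) : PureExp V

/-- Free variables of a pure expression. -/
def PureExp.fv {V : Type u} : PureExp V → Set V
  | .var x => {x}
  | .app e₁ e₂ => e₁.fv ∪ e₂.fv
  | .lam x e => e.fv \ {x}

/-- A pure program is a closed pure expression. -/
def PureExp.Closed {V : Type u} (e : PureExp V) : Prop := e.fv = ∅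

/-- `Exp_Γ`: extended lambda-expressions, which may contain nonterminals from `N`. -/
inductive ExtExp (V : Type u) (N : Type v) : Type (max u v)
  | var (x : V) : ExtExp V N
  | nt (A : N) : ExtExp V N
  | app (e₁ e₂ : ExtExp V N) : ExtExp V N
  | lam (x : V) (e : ExtExp V N) : ExtExp V N

namespace ExtExp

variable {V : Type u} {N : Type v}

/-- The occurrences of nonterminals in `e` (the index set of the multiset `nt(e)`). -/
def Occ : ExtExp V N → Type
  | .var _ => Empty
  | .nt _ => Unit
  | .app e₁ e₂ => e₁.Occ ⊕ e₂.Occ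
  | .lam _ e => e.Occ

/-- The nonterminal standing at an occurrence. -/
def occName : (e : ExtExp V N) → e.Occ → N
  | .nt A, _ => A
  | .app e₁ _, .inl i => e₁.occName i
  | .app _ e₂, .inr i => e₂.occName i
  | .lam _ e, i => e.occName i

/-- `e[t₁/X₁, …, tₖ/Xₖ]`: every nonterminal occurrence is replaced, independently of the
others, by a pure expression (bound variables are not renamed). -/
def subst : (e : ExtExp V N) → (e.Occ → PureExp V) → PureExp V
  | .var x, _ => .var x
  | .nt _, τ => τ ()
  | .app e₁ e₂, τ => .app (e₁.subst fun i => τ (.inl i)) (e₂.subst fun i => τ (.inr i))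
  | .lam x e, τ => .lam x (e.subst τ)

end ExtExp

/-- A lambda-regular grammar with nonterminals `N` (which is taken finite in the theorem):
a finite set of productions `A ::= e`. -/
structure Grammar (V : Type u) (N : Type v) where
  productions : Finset (N × ExtExp V N)

section Grammar

variable {V : Type u} {N : Type v} (Γ : Grammar V N)

/-- The derivation relation `e ⇒*_Γ t` between extended and pure expressions. -/
inductive Derives : ExtExp V N → PureExp V → Prop
  | subst (e : ExtExp V N) (τ : e.Occ → PureExp V)
      (h : ∀ i : e.Occ, Derives (.nt (e.occName i)) (τ i)) : Derives e (e.subst τ)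
  | prod {A : N} {e : ExtExp V N} {t : PureExp V}
      (hA : (A, e) ∈ Γ.productions) (h : Derives e t) : Derives (.nt A) t

/-- Free variables of an extended expression. -/
def extFv (e : ExtExp V N) : Set V := {x | ∃ t : PureExp V, Derives Γ e t ∧ x ∈ t.fv}

/-- An extended expression is closed iff all pure expressions derived from it are.
An extended program is a closed extended expression. -/
def ExtClosed (e : ExtExp V N) : Prop := ∀ t : PureExp V, Derives Γ e t → t.Closed

/-- `IsSubexp Γ t e` means `t ∈ subexps(e)`. -/
inductive IsSubexp : ExtExp V N → ExtExp V N → Prop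
  | refl (e : ExtExp V N) : IsSubexp e e
  | lam {t : ExtExp V N} {x : V} {e : ExtExp V N} (h : IsSubexp t e) : IsSubexp t (.lam x e)
  | appLeft {t e₁ e₂ : ExtExp V N} (h : IsSubexp t e₁) : IsSubexp t (.app e₁ e₂)
  | appRight {t e₁ e₂ : ExtExp V N} (h : IsSubexp t e₂) : IsSubexp t (.app e₁ e₂)
  | prod {t : ExtExp V N} {A : N} {e : ExtExp V N}
      (hA : (A, e) ∈ Γ.productions) (h : IsSubexp t e) : IsSubexp t (.nt A)

end Grammar

/-! ## Exact environment-based semantics of the pure calculus -/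

/-- Values are closures `λx.e : ρ`, where the environment `ρ` is a map from a finite set `dom`
of variables, containing the free variables of `λx.e`, to values. -/
inductive Value (V : Type u) : Type u
  | clo (x : V) (e : PureExp V) (dom : Finset V) (val : {y // y ∈ dom} → Value V)
      (hfv : (PureExp.lam x e).fv ⊆ ↑dom) : Value V

/-- Environments: maps from a finite set of variables to values. -/
structure Env (V : Type u) : Type u where
  dom : Finset V
  val : {y // y ∈ dom} → Value V

/-- The empty environment `[]`. -/
def Env.empty {V : Type u} : Env V := ⟨∅, fun y => absurd y.2 (Finset.notMem_empty y.1)⟩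

/-- The environment `ρ[x ↦ v]`. -/
def Env.update {V : Type u} [DecidableEq V] (ρ : Env V) (x : V) (v : Value V) : Env V where
  dom := insert x ρ.dom
  val := fun y => if h : y.1 = x then v else ρ.val ⟨y.1, Finset.mem_of_mem_insert_of_ne y.2 h⟩

/-- States `e : ρ` with `fv(e) ⊆ dom(ρ)`. -/
structure State (V : Type u) : Type u where
  exp : PureExp V
  env : Env V
  hfv : exp.fv ⊆ ↑env.dom

/-- The state `Q : []` of a closed pure expression `Q`. -/
def initState {V : Type u} (Q : PureExp V) (hQ : Q.Closed) : State V :=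
  ⟨Q, Env.empty, by rw [show Q.fv = ∅ from hQ]; exact Set.empty_subset _⟩

theorem fv_left {V : Type u} {e₁ e₂ : PureExp V} {S : Set V} (h : (PureExp.app e₁ e₂).fv ⊆ S) :
    e₁.fv ⊆ S := Set.subset_union_left.trans h

theorem fv_right {V : Type u} {e₁ e₂ : PureExp V} {S : Set V} (h : (PureExp.app e₁ e₂).fv ⊆ S) :
    e₂.fv ⊆ S := Set.subset_union_right.trans h

theorem fv_body {V : Type u} [DecidableEq V] {x : V} {e : PureExp V} {D : Finset V}
    (h : (PureExp.lam x e).fv ⊆ ↑D) : e.fv ⊆ ↑(insert x D) := by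
  intro y hy
  by_cases hyx : y = x
  · subst hyx; simp
  · have := h (show y ∈ (PureExp.lam x e).fv from ⟨hy, hyx⟩)
    simp only [Finset.coe_insert]
    exact Set.mem_insert_of_mem _ this

/-- The kinds of calls: operator, operand, function call, nonterminal (extended calculus only). -/
inductive CallKind
  | r | d | c | n

mutual
/-- Exact evaluation `s ⇓ v`. -/
inductive Eval {V : Type u} [DecidableEq V] : State V → Value V → Prop
  | value (x : V) (e : PureExp V) (ρ : Env V) (h : (PureExp.lam x e).fv ⊆ ↑ρ.dom) :
      Eval ⟨.lam x e, ρ, h⟩ (.clo x e ρ.dom ρ.val h)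
  | var (x : V) (ρ : Env V) (h : (PureExp.var x).fv ⊆ ↑ρ.dom) :
      Eval ⟨.var x, ρ, h⟩ (ρ.val ⟨x, h rfl⟩)
  | apply {e₁ e₂ : PureExp V} {ρ : Env V} {h : (PureExp.app e₁ e₂).fv ⊆ ↑ρ.dom}
      {s' : State V} {w : Value V}
      (hc : Call .c ⟨.app e₁ e₂, ρ, h⟩ s') (he : Eval s' w) : Eval ⟨.app e₁ e₂, ρ, h⟩ w

/-- Exact calls `s → s'` of kinds `r`, `d`, `c`. -/
inductive Call {V : Type u} [DecidableEq V] : CallKind → State V → State V → Prop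
  | operator (e₁ e₂ : PureExp V) (ρ : Env V) (h : (PureExp.app e₁ e₂).fv ⊆ ↑ρ.dom) :
      Call .r ⟨.app e₁ e₂, ρ, h⟩ ⟨e₁, ρ, fv_left h⟩
  | operand {e₁ e₂ : PureExp V} {ρ : Env V} {h : (PureExp.app e₁ e₂).fv ⊆ ↑ρ.dom}
      {v₁ : Value V} (h₁ : Eval ⟨e₁, ρ, fv_left h⟩ v₁) :
      Call .d ⟨.app e₁ e₂, ρ, h⟩ ⟨e₂, ρ, fv_right h⟩
  | call {e₁ e₂ : PureExp V} {ρ : Env V} {h : (PureExp.app e₁ e₂).fv ⊆ ↑ρ.dom}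
      {x : V} {e₀ : PureExp V} {ρ₀ : Env V} {h₀ : (PureExp.lam x e₀).fv ⊆ ↑ρ₀.dom}
      {v₂ : Value V}
      (h₁ : Eval ⟨e₁, ρ, fv_left h⟩ (.clo x e₀ ρ₀.dom ρ₀.val h₀))
      (h₂ : Eval ⟨e₂, ρ, fv_right h⟩ v₂) :
      Call .c ⟨.app e₁ e₂, ρ, h⟩ ⟨e₀, ρ₀.update x v₂, fv_body h₀⟩
end

/-- `Q : [] ⇓`, i.e. `Q` is closed and its evaluation terminates with some value. -/
def Terminates {V : Type u} [DecidableEq V] (Q : PureExp V) : Prop :=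
  ∃ (hQ : Q.Closed) (w : Value V), Eval (initState Q hQ) w

/-- An infinite call sequence `Q : [] = s₀ → s₁ → s₂ → …` in the exact semantics. -/
structure IsInfiniteCallSeq {V : Type u} [DecidableEq V] (Q : PureExp V) (hQ : Q.Closed)
    (s : ℕ → State V) : Prop where
  start : s 0 = initState Q hQ
  step : ∀ i, ∃ k, Call k (s i) (s (i + 1))

/-- `P` is `Γ`-terminating: every pure expression obtained from `P` by replacing each occurrence
of a nonterminal by a pure expression derivable from it terminates. -/
def GammaTerminating {V : Type u} {N : Type v} [DecidableEq V] (Γ : Grammar V N)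
    (P : ExtExp V N) : Prop :=
  ∀ τ : P.Occ → PureExp V, (∀ i, Derives Γ (.nt (P.occName i)) (τ i)) → Terminates (P.subst τ)

/-! ## Size-change graphs -/

/-- Graph nodes: variables and the empty name path `ε`. -/
inductive Node (V : Type u) : Type u
  | eps : Node V
  | var (x : V) : Node V

/-- Arc labels `=` and `↓`. -/
inductive Label
  | eq | down

/-- A size-change graph is given by its set of labelled arcs. The graph `G` of a judgement about
`e` and `e'` has source `fv(e) ∪ {ε}` and target `fv(e') ∪ {ε}`. -/
abbrev Graph (V : Type u) : Type u := Set (Node V × Label × Node V)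

section Graphs

variable {V : Type u} {N : Type v}

/-- The labels on all two-arc paths from `p` through `G₁` and then `G₂` to `q`. -/
def pathLabels (G₁ G₂ : Graph V) (p q : Node V) : Set Label :=
  {l | ∃ (m : Node V) (r s : Label), (p, r, m) ∈ G₁ ∧ (m, s, q) ∈ G₂ ∧ (l = r ∨ l = s)}

/-- Composition `G₁ ; G₂`. -/
def Graph.comp (G₁ G₂ : Graph V) : Graph V :=
  {a | ∃ p q, a = (p, Label.down, q) ∧ Label.down ∈ pathLabels G₁ G₂ p q} ∪
  {a | ∃ p q, a = (p, Label.eq, q) ∧ pathLabels G₁ G₂ p q = {Label.eq}}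

/-- `id^=_e`. -/
def idEq (Γ : Grammar V N) (e : ExtExp V N) : Graph V :=
  {(.eps, .eq, .eps)} ∪ {a | ∃ y ∈ extFv Γ e, a = (.var y, .eq, .var y)}

/-- `id^↓_e`. -/
def idDown (Γ : Grammar V N) (e : ExtExp V N) : Graph V :=
  {(.eps, .down, .eps)} ∪ {a | ∃ y ∈ extFv Γ e, a = (.var y, .eq, .var y)}

/-- The graph of a variable evaluation `x ⇓ w`. -/
def varGraph (Γ : Grammar V N) (x : V) (w : ExtExp V N) : Graph V :=
  {(.var x, .eq, .eps)} ∪ {a | ∃ y ∈ extFv Γ w, a = (.var x, .down, .var y)}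

open Classical in
/-- `G^{-ε/λx.e₀}`. -/
noncomputable def dropEps (Γ : Grammar V N) (x : V) (e₀ : ExtExp V N) (G : Graph V) : Graph V :=
  if x ∈ extFv Γ e₀ then
    {a | ∃ y r z, (Node.var y, r, Node.var z) ∈ G ∧ a = (.var y, r, .var z)} ∪
    {a | ∃ r z, (Node.eps, r, Node.var z) ∈ G ∧ a = (.eps, .down, .var z)}
  else
    {a | ∃ y r z, (Node.var y, r, Node.var z) ∈ G ∧ a = (.var y, r, .var z)} ∪
    {a | ∃ r q, (Node.eps, r, q) ∈ G ∧ a = (.eps, .down, q)} ∪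
    {a | ∃ p r, (p, r, Node.eps) ∈ G ∧ a = (p, .down, .eps)}

/-- `G^{ε↦x}`. -/
def epsTo (x : V) (G : Graph V) : Graph V :=
  {a | ∃ y r, (Node.var y, r, Node.eps) ∈ G ∧ a = (.var y, r, .var x)} ∪
  {a | ∃ r, (Node.eps, r, Node.eps) ∈ G ∧ a = (.eps, .down, .var x)}

/-- `G ∪_e G'`: the arcs of `G ∪ G'` that end in `fv(e) ∪ {ε}`. -/
def unionRestrict (Γ : Grammar V N) (e : ExtExp V N) (G G' : Graph V) : Graph V :=
  {a | a ∈ G ∪ G' ∧ (a.2.2 = .eps ∨ ∃ y ∈ extFv Γ e, a.2.2 = .var y)}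

/-- The infinite multipath `G₀, G₁, …` has a thread of infinite descent: a sequence of arcs
`a_k → a_{k+1}` of `G_k` for all `k ≥ j` (some `j`), infinitely many of them labelled `↓`. -/
def HasInfinitelyDescendingThread (G : ℕ → Graph V) : Prop :=
  ∃ (j : ℕ) (a : ℕ → Node V) (r : ℕ → Label),
    (∀ k, j ≤ k → (a k, r k, a (k + 1)) ∈ G k) ∧ {k | j ≤ k ∧ r k = Label.down}.Infinite

end Graphs

/-! ## Approximate extended semantics with size-change graphs -/

mutual
/-- Approximate evaluation `e ⇓ w, G` relative to the program `P` under analysis. -/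
inductive AEval {V : Type u} {N : Type v} (Γ : Grammar V N) (P : ExtExp V N) :
    ExtExp V N → ExtExp V N → Graph V → Prop
  | value (x : V) (e : ExtExp V N) : AEval Γ P (.lam x e) (.lam x e) (idEq Γ (.lam x e))
  | var {x : V} {e₁ e₂ e₀ v₂ : ExtExp V N} {G₁ G₂ : Graph V}
      (hP : IsSubexp Γ (.app e₁ e₂) P)
      (h₁ : AEval Γ P e₁ (.lam x e₀) G₁) (h₂ : AEval Γ P e₂ v₂ G₂) :
      AEval Γ P (.var x) v₂ (varGraph Γ x v₂)
  | result {k : CallKind} {e e' w : ExtExp V N} {G' G : Graph V}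
      (hk : k = .c ∨ k = .n) (hc : ACall Γ P k e e' G') (he : AEval Γ P e' w G) :
      AEval Γ P e w (G'.comp G)

/-- Approximate calls `e → e', G` of kinds `r`, `d`, `c`, `n`. -/
inductive ACall {V : Type u} {N : Type v} (Γ : Grammar V N) (P : ExtExp V N) :
    CallKind → ExtExp V N → ExtExp V N → Graph V → Prop
  | gram {A : N} {e : ExtExp V N} (hA : (A, e) ∈ Γ.productions) :
      ACall Γ P .n (.nt A) e (idEq Γ e)
  | operator (e₁ e₂ : ExtExp V N) : ACall Γ P .r (.app e₁ e₂) e₁ (idDown Γ e₁)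
  | operand (e₁ e₂ : ExtExp V N) : ACall Γ P .d (.app e₁ e₂) e₂ (idDown Γ e₂)
  | call {e₁ e₂ e₀ v₂ : ExtExp V N} {x : V} {G₁ G₂ : Graph V}
      (h₁ : AEval Γ P e₁ (.lam x e₀) G₁) (h₂ : AEval Γ P e₂ v₂ G₂) :
      ACall Γ P .c (.app e₁ e₂) e₀ (unionRestrict Γ e₀ (dropEps Γ x e₀ G₁) (epsTo x G₂))
end

/-- An infinite call sequence `P = e₀ → e₁, G₀`, `e₁ → e₂, G₁`, … in the approximate extended
semantics of `P`. -/
structure IsApproxInfiniteCallSeq {V : Type u} {N : Type v} (Γ : Grammar V N) (P : ExtExp V N)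
    (e : ℕ → ExtExp V N) (G : ℕ → Graph V) : Prop where
  start : e 0 = P
  step : ∀ i, ∃ k, ACall Γ P k (e i) (e (i + 1)) (G i)

end LambdaSCT

namespace LambdaSCT

universe u v

variable {V : Type u} {N : Type v}

/-! ## Derivations and subexpressions -/

section Derivations

variable {Γ : Grammar V N}

-- Give every exact state a natural number, its weight: the size of its expression, where each free
-- variable also counts the weight of the closure bound to it. A node `ε` weighs as much as the
-- whole state, a node `y` as much as the value of `y`. A graph is safe for a pair of weightings if
-- no arc increases the weight and every `↓` arc decreases it. Identity graphs, variable graphs and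
-- call graphs are safe for the exact steps they describe, and composition preserves safety.
--
-- The approximate semantics simulates the exact one (`Eval.simulates`, `Abstracts.exists_call`). An
-- extended expression abstracts a state if it lies in `subexps(P)`, derives the pure expression,
-- and each environment binding stems from an application in `subexps(P)` whose operator and operand
-- have the corresponding approximate evaluations. Each exact step is matched by an approximate one
-- with a safe graph, up to `n` calls that unfold nonterminals and leave the state unchanged.
--
-- An infinite exact call sequence thus yields an infinite approximate one with safe graphs
-- throughout. An infinitely descending thread in it would be an infinite descent in the natural
-- numbers (`not_hasInfinitelyDescendingThread`). For termination, a state without a value always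
-- calls another such state, so a nonterminating program has an infinite exact call sequence.

theorem Derives.eq_var {x : V} {t : PureExp V} (h : Derives Γ (.var x) t) : t = .var x := by
  cases h with
  | subst _ τ h => rfl

theorem Derives.exists_app {e₁ e₂ : ExtExp V N} {t : PureExp V} (h : Derives Γ (.app e₁ e₂) t) :
    ∃ t₁ t₂, t = .app t₁ t₂ ∧ Derives Γ e₁ t₁ ∧ Derives Γ e₂ t₂ := by
  cases h with
  | subst _ τ h =>
    exact ⟨_, _, rfl, .subst e₁ _ fun i => h (.inl i), .subst e₂ _ fun i => h (.inr i)⟩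

theorem Derives.exists_lam {x : V} {e : ExtExp V N} {t : PureExp V} (h : Derives Γ (.lam x e) t) :
    ∃ t₀, t = .lam x t₀ ∧ Derives Γ e t₀ := by
  cases h with
  | subst _ τ h => exact ⟨_, rfl, .subst e τ h⟩

/-- Rule (i) applied to a lone nonterminal only repeats a derivation from that same nonterminal; a
finite derivation must eventually use a production. -/
theorem Derives.exists_production {e : ExtExp V N} {t : PureExp V} (h : Derives Γ e t) :
    ∀ A, e = .nt A → ∃ e', (A, e') ∈ Γ.productions ∧ Derives Γ e' t := by
  induction h with
  | subst e τ h ih =>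
    rintro A rfl
    exact ih () A rfl
  | prod hA h _ =>
    intro A hAe
    cases hAe
    exact ⟨_, hA, h⟩

/-- Unfolding a nonterminal at the root by finitely many productions. -/
inductive Unfolds (Γ : Grammar V N) : ExtExp V N → ExtExp V N → Prop
  | refl (e : ExtExp V N) : Unfolds Γ e e
  | step {A : N} {e e' : ExtExp V N} (hA : (A, e) ∈ Γ.productions) (h : Unfolds Γ e e') :
      Unfolds Γ (.nt A) e'

/-- Derivations are finite, so the unfoldings that one performs at the root come to an end, even
with cyclic productions such as `A ::= A`. -/
theorem Derives.exists_unfolds {e : ExtExp V N} {t : PureExp V} (h : Derives Γ e t) :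
    ∃ e', Unfolds Γ e e' ∧ Derives Γ e' t ∧ ∀ A, e' ≠ .nt A := by
  induction h with
  | subst e τ h ih =>
    cases e with
    | nt A => exact ih ()
    | var x => exact ⟨_, .refl _, .subst _ τ h, by simp⟩
    | app e₁ e₂ => exact ⟨_, .refl _, .subst _ τ h, by simp⟩
    | lam x e => exact ⟨_, .refl _, .subst _ τ h, by simp⟩
  | prod hA h ih =>
    obtain ⟨e', hu, hd, hn⟩ := ih
    exact ⟨e', .step hA hu, hd, hn⟩

theorem notMem_extFv_lam {x : V} {e : ExtExp V N} : x ∉ extFv Γ (.lam x e) := by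
  rintro ⟨t, ht, hx⟩
  obtain ⟨t₀, rfl, -⟩ := ht.exists_lam
  exact hx.2 rfl

theorem IsSubexp.trans {a b c : ExtExp V N} (hab : IsSubexp Γ a b) (hbc : IsSubexp Γ b c) :
    IsSubexp Γ a c := by
  induction hbc with
  | refl => exact hab
  | lam _ ih => exact .lam ih
  | appLeft _ ih => exact .appLeft ih
  | appRight _ ih => exact .appRight ih
  | prod hA _ ih => exact .prod hA ih

theorem Unfolds.isSubexp {e e' : ExtExp V N} (h : Unfolds Γ e e') : IsSubexp Γ e' e := by
  induction h with
  | refl => exact .refl _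
  | step hA _ ih => exact .prod hA ih

end Derivations

/-! ## Weights of states and values -/

section Weights

/-- The weight of a pure expression whose free variables carry the weights `w`. -/
def PureExp.weight [DecidableEq V] : PureExp V → (V → ℕ) → ℕ
  | .var x, w => w x + 1
  | .app e₁ e₂, w => e₁.weight w + e₂.weight w + 1
  -- Weight 0 for the bound variable hides any outer binding of the same name.
  | .lam x e, w => e.weight (Function.update w x 0) + 1

variable [DecidableEq V]

theorem PureExp.weight_congr (e : PureExp V) {w w' : V → ℕ} (h : ∀ y ∈ e.fv, w y = w' y) :
    e.weight w = e.weight w' := by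
  induction e generalizing w w' with
  | var x => simp [weight, h x rfl]
  | app e₁ e₂ ih₁ ih₂ =>
    simp only [weight]
    rw [ih₁ fun y hy => h y (.inl hy), ih₂ fun y hy => h y (.inr hy)]
  | lam x e ih =>
    simp only [weight]
    rw [ih]
    intro y hy
    by_cases hyx : y = x
    · simp [hyx]
    · simpa [hyx] using h y ⟨hy, hyx⟩

/-- Each leaf adds 1 to the weight of its variable, so the inequality is strict even for `e = y`. It
makes the `↓` arcs of `varGraph` safe. -/
theorem PureExp.lt_weight (e : PureExp V) {w : V → ℕ} {y : V} (hy : y ∈ e.fv) :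
    w y < e.weight w := by
  induction e generalizing w with
  | var x =>
    obtain rfl : y = x := hy
    simp [weight]
  | app e₁ e₂ ih₁ ih₂ =>
    rcases hy with hy | hy
    · have := ih₁ (w := w) hy
      simp only [weight]
      lia
    · have := ih₂ (w := w) hy
      simp only [weight]
      lia
  | lam x e ih =>
    have := ih (w := Function.update w x 0) hy.1
    rw [Function.update_of_ne hy.2] at this
    simp only [weight]
    lia

theorem PureExp.weight_pos (e : PureExp V) (w : V → ℕ) : 0 < e.weight w := by
  cases e <;> simp [weight]

/-- If `x` is not free, its weight is irrelevant to the body, and the abstraction just adds 1. This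
justifies the `↓` arcs into `ε` that `dropEps` keeps. -/
theorem PureExp.weight_lt_weight_lam (e : PureExp V) {x : V} (hx : x ∉ e.fv) {w w' : V → ℕ}
    (h : ∀ y, y ≠ x → w y = w' y) : e.weight w < (PureExp.lam x e).weight w' := by
  rw [weight, e.weight_congr (w' := Function.update w' x 0)]
  · exact Nat.lt_succ_self _
  · intro y hy
    have hyx : y ≠ x := fun hyx => hx (hyx ▸ hy)
    rw [Function.update_of_ne hyx, h y hyx]

/-- The weight of a value. -/
def Value.weight : Value V → ℕ
  | .clo x e dom val _ =>
    -- The default 0 is never counted: the free variables of the closure lie in `dom`.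
    (PureExp.lam x e).weight fun y => if h : y ∈ dom then (val ⟨y, h⟩).weight else 0

/-- The weights of the values in an environment, and `0` outside its domain. -/
def Env.weight (ρ : Env V) (y : V) : ℕ :=
  if h : y ∈ ρ.dom then (ρ.val ⟨y, h⟩).weight else 0

theorem Env.weight_of_mem {ρ : Env V} {y : V} (h : y ∈ ρ.dom) :
    ρ.weight y = (ρ.val ⟨y, h⟩).weight := dif_pos h

theorem Env.weight_update_self (ρ : Env V) (x : V) (v : Value V) :
    (ρ.update x v).weight x = v.weight := by
  simp [Env.weight, Env.update]

theorem Env.weight_update_of_ne (ρ : Env V) {x y : V} (v : Value V) (h : y ≠ x) :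
    (ρ.update x v).weight y = ρ.weight y := by
  simp [Env.weight, Env.update, h]

open Classical in
/-- The weight that the state `e : ρ` gives to a node: the weight of the state itself for `ε`,
and that of `ρ(y)` for a free variable `y` of `e`. -/
noncomputable def State.nodeWeight (s : State V) : Node V → ℕ
  | .eps => s.exp.weight s.env.weight
  -- Graphs mention the free variables of the extended expression, which may be missing from the
  -- pure one. An environment entry for such a variable could outweigh the state; the value 0 keeps
  -- every variable node below `ε`.
  | .var y => if y ∈ s.exp.fv then s.env.weight y else 0

/-- A value as a state. -/
def Value.toState : Value V → State V
  | .clo x e dom val h => ⟨.lam x e, ⟨dom, val⟩, h⟩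

theorem Value.nodeWeight_eps (v : Value V) : v.toState.nodeWeight .eps = v.weight := by
  cases v
  rw [Value.weight]
  rfl

theorem State.nodeWeight_var_of_mem (s : State V) {y : V} (h : y ∈ s.exp.fv) :
    s.nodeWeight (.var y) = s.env.weight y := if_pos h

theorem State.nodeWeight_var_of_notMem (s : State V) {y : V} (h : y ∉ s.exp.fv) :
    s.nodeWeight (.var y) = 0 := if_neg h

theorem State.nodeWeight_var_lt (s : State V) (y : V) :
    s.nodeWeight (.var y) < s.nodeWeight .eps := by
  by_cases h : y ∈ s.exp.fv
  · rw [s.nodeWeight_var_of_mem h]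
    exact s.exp.lt_weight h
  · rw [s.nodeWeight_var_of_notMem h]
    exact s.exp.weight_pos _

theorem State.nodeWeight_var_mono {e e' : PureExp V} {ρ : Env V} (h : e.fv ⊆ ρ.dom)
    (h' : e'.fv ⊆ ρ.dom) (hfv : e.fv ⊆ e'.fv) (y : V) :
    (⟨e, ρ, h⟩ : State V).nodeWeight (.var y) ≤ (⟨e', ρ, h'⟩ : State V).nodeWeight (.var y) := by
  by_cases hy : y ∈ e.fv
  · rw [nodeWeight_var_of_mem _ hy, nodeWeight_var_of_mem _ (hfv hy)]
  · rw [nodeWeight_var_of_notMem _ hy]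
    exact Nat.zero_le _

end Weights

/-! ## Safe graphs -/

section Safety

/-- Weights do not increase along the arcs of `G`, and decrease along those labelled `↓`. -/
def Graph.Safe (G : Graph V) (f g : Node V → ℕ) : Prop :=
  ∀ p r q, (p, r, q) ∈ G → g q ≤ f p ∧ (r = .down → g q < f p)

/-- The arcs of `G` to variables end in the free variables of `e`. -/
def Graph.EndsIn (Γ : Grammar V N) (G : Graph V) (e : ExtExp V N) : Prop :=
  ∀ p r z, (p, r, Node.var z) ∈ G → z ∈ extFv Γ e

/-- One strict link makes a chain of weak inequalities strict. An `=` arc claims only the weak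
inequality, so any single path witnesses it. -/
theorem Graph.Safe.comp {G₁ G₂ : Graph V} {f g h : Node V → ℕ} (h₁ : G₁.Safe f g)
    (h₂ : G₂.Safe g h) : (G₁.comp G₂).Safe f h := by
  rintro p r q (⟨p', q', heq, m, r', s', hr, hs, hl⟩ | ⟨p', q', heq, hl⟩)
  · cases heq
    obtain ⟨a, a'⟩ := h₁ _ _ _ hr
    obtain ⟨b, b'⟩ := h₂ _ _ _ hs
    refine ⟨b.trans a, fun _ => ?_⟩
    rcases hl with hl | hl
    · exact b.trans_lt (a' hl.symm)
    · exact (b' hl.symm).trans_le a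
  · cases heq
    obtain ⟨m, r', s', hr, hs, -⟩ : Label.eq ∈ pathLabels G₁ G₂ p q := by rw [hl]; rfl
    exact ⟨(h₂ _ _ _ hs).1.trans (h₁ _ _ _ hr).1, nofun⟩

theorem Graph.EndsIn.comp {Γ : Grammar V N} {G₁ G₂ : Graph V} {e : ExtExp V N}
    (h₂ : G₂.EndsIn Γ e) : (G₁.comp G₂).EndsIn Γ e := by
  rintro p r z (⟨p', q', heq, m, r', s', hr, hs, hl⟩ | ⟨p', q', heq, hl⟩)
  · cases heq
    exact h₂ _ _ _ hs
  · cases heq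
    obtain ⟨m, r', s', hr, hs, -⟩ : Label.eq ∈ pathLabels G₁ G₂ p (.var z) := by rw [hl]; rfl
    exact h₂ _ _ _ hs

theorem idEq_safe (Γ : Grammar V N) (e : ExtExp V N) (f : Node V → ℕ) :
    (idEq Γ e).Safe f f := by
  rintro p r q (heq | ⟨y, -, heq⟩) <;> cases heq <;> exact ⟨le_rfl, nofun⟩

theorem idEq_endsIn (Γ : Grammar V N) (e : ExtExp V N) : (idEq Γ e).EndsIn Γ e := by
  rintro p r q (heq | ⟨y, hy, heq⟩) <;> cases heq
  exact hy

theorem idDown_safe (Γ : Grammar V N) (e : ExtExp V N) {f g : Node V → ℕ}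
    (heps : g .eps < f .eps) (hvar : ∀ y, g (.var y) ≤ f (.var y)) : (idDown Γ e).Safe f g := by
  rintro p r q (heq | ⟨y, -, heq⟩) <;> cases heq
  · exact ⟨heps.le, fun _ => heps⟩
  · exact ⟨hvar y, nofun⟩

theorem varGraph_endsIn (Γ : Grammar V N) (x : V) (e : ExtExp V N) :
    (varGraph Γ x e).EndsIn Γ e := by
  rintro p r q (heq | ⟨y, hy, heq⟩) <;> cases heq
  exact hy

theorem unionRestrict_safe {Γ : Grammar V N} {e : ExtExp V N} {G G' : Graph V}
    {f g : Node V → ℕ} (hG : G.Safe f g) (hG' : G'.Safe f g) :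
    (unionRestrict Γ e G G').Safe f g := by
  rintro p r q ⟨hmem | hmem, -⟩
  · exact hG _ _ _ hmem
  · exact hG' _ _ _ hmem

/-- Along a safe multipath there is no thread of infinite descent. -/
theorem not_hasInfinitelyDescendingThread {G : ℕ → Graph V} {f : ℕ → Node V → ℕ}
    (hG : ∀ i, (G i).Safe (f i) (f (i + 1))) : ¬ HasInfinitelyDescendingThread G := by
  rintro ⟨j, a, r, harc, hinf⟩
  -- The weights along the thread never increase, hence are constant from some point on; a `↓` arc
  -- beyond that point is a contradiction.
  have hanti : Antitone fun k => f (j + k) (a (j + k)) :=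
    antitone_nat_of_succ_le fun k => (hG _ _ _ _ (harc _ (Nat.le_add_right j k))).1
  obtain ⟨n, hn⟩ := WellFoundedLT.antitone_chain_condition hanti
  obtain ⟨k, ⟨hjk, hr⟩, hk⟩ := hinf.exists_gt (j + n)
  have hlt := (hG _ _ _ _ (harc k hjk)).2 hr
  have h₁ := hn (k - j) (by lia)
  have h₂ := hn (k + 1 - j) (by lia)
  simp only [show j + (k - j) = k by lia, show j + (k + 1 - j) = k + 1 by lia] at h₁ h₂
  lia

variable [DecidableEq V]

theorem varGraph_safe (Γ : Grammar V N) (e : ExtExp V N) {x : V} {ρ : Env V}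
    (h : (PureExp.var x).fv ⊆ ρ.dom) :
    (varGraph Γ x e).Safe (⟨.var x, ρ, h⟩ : State V).nodeWeight
      (ρ.val ⟨x, h rfl⟩).toState.nodeWeight := by
  have hx : (⟨.var x, ρ, h⟩ : State V).nodeWeight (.var x) =
      (ρ.val ⟨x, h rfl⟩).toState.nodeWeight .eps := by
    rw [State.nodeWeight_var_of_mem _ rfl, Value.nodeWeight_eps]
    exact Env.weight_of_mem _
  rintro p r q (heq | ⟨y, -, heq⟩) <;> cases heq <;> rw [hx]
  · exact ⟨le_rfl, nofun⟩
  · have := (ρ.val ⟨x, h rfl⟩).toState.nodeWeight_var_lt y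
    exact ⟨this.le, fun _ => this⟩

/-- Here `f` is meant for the operator and `f'` for the whole application; the strict drop at `ε`
pays for relabelling the arcs from `ε` with `↓`. -/
theorem dropEps_safe {Γ : Grammar V N} {x : V} {e₀ : ExtExp V N} {G : Graph V}
    {t₀ : PureExp V} {ρ₀ : Env V} {h₀ : (PureExp.lam x t₀).fv ⊆ ρ₀.dom} {v : Value V}
    {f f' : Node V → ℕ} (hd : Derives Γ e₀ t₀) (hend : G.EndsIn Γ (.lam x e₀))
    (hG : G.Safe f (⟨.lam x t₀, ρ₀, h₀⟩ : State V).nodeWeight)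
    (heps : f .eps < f' .eps) (hvar : ∀ y, f (.var y) ≤ f' (.var y)) :
    (dropEps Γ x e₀ G).Safe f' (⟨t₀, ρ₀.update x v, fv_body h₀⟩ : State V).nodeWeight := by
  have hle : ∀ p, f p ≤ f' p := by
    rintro (_ | y)
    · exact heps.le
    · exact hvar y
  have hz : ∀ {p r z}, (p, r, Node.var z) ∈ G →
      (⟨t₀, ρ₀.update x v, fv_body h₀⟩ : State V).nodeWeight (.var z) ≤
        (⟨.lam x t₀, ρ₀, h₀⟩ : State V).nodeWeight (.var z) := by
    intro p r z hmem
    -- The call rebinds `x` to a value of arbitrary weight, so arcs to `x` would be unsafe; there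
    -- are none, since `x` is not free in the abstraction.
    have hzx : z ≠ x := by
      rintro rfl
      exact notMem_extFv_lam (hend _ _ _ hmem)
    by_cases hfv : z ∈ t₀.fv
    · rw [State.nodeWeight_var_of_mem _ hfv, State.nodeWeight_var_of_mem _ (show z ∈ (PureExp.lam x t₀).fv from ⟨hfv, hzx⟩),
        Env.weight_update_of_ne _ _ hzx]
    · rw [State.nodeWeight_var_of_notMem _ hfv]
      exact Nat.zero_le _
  have hvv : ∀ {y r z}, (Node.var y, r, Node.var z) ∈ G →
      (⟨t₀, ρ₀.update x v, fv_body h₀⟩ : State V).nodeWeight (.var z) ≤ f' (.var y) ∧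
        (r = .down →
          (⟨t₀, ρ₀.update x v, fv_body h₀⟩ : State V).nodeWeight (.var z) < f' (.var y)) := by
    intro y r z hmem
    obtain ⟨a, a'⟩ := hG _ _ _ hmem
    exact ⟨((hz hmem).trans a).trans (hvar y),
      fun hr => ((hz hmem).trans_lt (a' hr)).trans_le (hvar y)⟩
  have hev : ∀ {r z}, (Node.eps, r, Node.var z) ∈ G →
      (⟨t₀, ρ₀.update x v, fv_body h₀⟩ : State V).nodeWeight (.var z) < f' .eps :=
    fun hmem => ((hz hmem).trans (hG _ _ _ hmem).1).trans_lt heps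
  intro p r q hmem
  unfold dropEps at hmem
  split_ifs at hmem with hx
  · rcases hmem with ⟨y, r, z, hmem, heq⟩ | ⟨r, z, hmem, heq⟩ <;> cases heq
    · exact hvv hmem
    · exact ⟨(hev hmem).le, fun _ => hev hmem⟩
  · have hx' : x ∉ t₀.fv := fun h => hx ⟨t₀, hd, h⟩
    have hlt : (⟨t₀, ρ₀.update x v, fv_body h₀⟩ : State V).nodeWeight .eps <
        (⟨.lam x t₀, ρ₀, h₀⟩ : State V).nodeWeight .eps :=
      t₀.weight_lt_weight_lam hx' fun y hy => Env.weight_update_of_ne _ _ hy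
    have hpe : ∀ {p r}, (p, r, Node.eps) ∈ G →
        (⟨t₀, ρ₀.update x v, fv_body h₀⟩ : State V).nodeWeight .eps < f' p :=
      fun hmem => (hlt.trans_le (hG _ _ _ hmem).1).trans_le (hle _)
    rcases hmem with (⟨y, r, z, hmem, heq⟩ | ⟨r, q, hmem, heq⟩) | ⟨p, r, hmem, heq⟩ <;> cases heq
    · exact hvv hmem
    · cases q with
      | eps => exact ⟨(hpe hmem).le, fun _ => hpe hmem⟩
      | var z => exact ⟨(hev hmem).le, fun _ => hev hmem⟩
    · exact ⟨(hpe hmem).le, fun _ => hpe hmem⟩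

/-- The operand's value becomes the value of `x`, so `ε` turns into `x`. The weight can only drop in
passing, namely to 0 if `x` is not free in `t₀`. -/
theorem epsTo_safe {x : V} {G : Graph V} {t₀ : PureExp V} {ρ₀ : Env V}
    {h₀ : (PureExp.lam x t₀).fv ⊆ ρ₀.dom} {v : Value V} {f f' : Node V → ℕ}
    (hG : G.Safe f v.toState.nodeWeight)
    (heps : f .eps < f' .eps) (hvar : ∀ y, f (.var y) ≤ f' (.var y)) :
    (epsTo x G).Safe f' (⟨t₀, ρ₀.update x v, fv_body h₀⟩ : State V).nodeWeight := by
  have hx : (⟨t₀, ρ₀.update x v, fv_body h₀⟩ : State V).nodeWeight (.var x) ≤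
      v.toState.nodeWeight .eps := by
    by_cases hfv : x ∈ t₀.fv
    · rw [State.nodeWeight_var_of_mem _ hfv, Env.weight_update_self, Value.nodeWeight_eps]
    · rw [State.nodeWeight_var_of_notMem _ hfv]
      exact Nat.zero_le _
  rintro p r q (⟨y, r, hmem, heq⟩ | ⟨r, hmem, heq⟩) <;> cases heq <;>
    obtain ⟨a, a'⟩ := hG _ _ _ hmem
  · exact ⟨(hx.trans a).trans (hvar y), fun hr => (hx.trans_lt (a' hr)).trans_le (hvar y)⟩
  · exact ⟨((hx.trans a).trans_lt heps).le, fun _ => (hx.trans a).trans_lt heps⟩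

end Safety

/-! ## Simulation of the exact by the approximate semantics -/

section Simulation

variable (Γ : Grammar V N) (P : ExtExp V N)

/-- In the approximate semantics, `y` may be bound to `w`. -/
def MayBind (y : V) (w : ExtExp V N) : Prop :=
  ∃ e₁ e₂ e₀ G₁ G₂, IsSubexp Γ (.app e₁ e₂) P ∧ AEval Γ P e₁ (.lam y e₀) G₁ ∧ AEval Γ P e₂ w G₂

/-- The extended expression `w` abstracts a value. -/
inductive AbstractsValue : ExtExp V N → Value V → Prop
  | clo {x : V} {e : ExtExp V N} {t : PureExp V} {dom : Finset V}
      {val : {y // y ∈ dom} → Value V} {hfv : (PureExp.lam x t).fv ⊆ ↑dom}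
      (hsub : IsSubexp Γ (.lam x e) P) (hd : Derives Γ e t)
      -- The approximate semantics keeps no environments, so each variable has its own witness,
      -- possibly from an unrelated application.
      (w : {y // y ∈ dom} → ExtExp V N) (hb : ∀ y, MayBind Γ P y.1 (w y))
      (hw : ∀ y, AbstractsValue (w y) (val y)) :
      AbstractsValue (.lam x e) (.clo x t dom val hfv)

/-- The bindings of an environment are among those of the approximate semantics. -/
def AbstractsEnv (ρ : Env V) : Prop :=
  ∀ y : {y // y ∈ ρ.dom}, ∃ w, MayBind Γ P y.1 w ∧ AbstractsValue Γ P w (ρ.val y)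

/-- The extended expression `e` abstracts a state. -/
structure Abstracts (e : ExtExp V N) (s : State V) : Prop where
  isSubexp : IsSubexp Γ e P
  derives : Derives Γ e s.exp
  env : AbstractsEnv Γ P s.env

variable {Γ P}

theorem AbstractsValue.exists_lam {w : ExtExp V N} {x : V} {t : PureExp V} {dom : Finset V}
    {val : {y // y ∈ dom} → Value V} {h : (PureExp.lam x t).fv ⊆ ↑dom}
    (hw : AbstractsValue Γ P w (.clo x t dom val h)) :
    ∃ e, w = .lam x e ∧ IsSubexp Γ (.lam x e) P ∧ Derives Γ e t ∧
      AbstractsEnv Γ P ⟨dom, val⟩ := by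
  cases hw with
  | clo hsub hd w hb hw => exact ⟨_, rfl, hsub, hd, fun y => ⟨w y, hb y, hw y⟩⟩

theorem AbstractsEnv.update [DecidableEq V] {ρ : Env V} (hρ : AbstractsEnv Γ P ρ) {x : V}
    {w : ExtExp V N} {v : Value V} (hb : MayBind Γ P x w) (hw : AbstractsValue Γ P w v) :
    AbstractsEnv Γ P (ρ.update x v) := by
  rintro ⟨y, hy⟩
  by_cases hyx : y = x
  · subst hyx
    exact ⟨w, hb, by simpa [Env.update] using hw⟩
  · simpa [Env.update, hyx] using hρ ⟨y, Finset.mem_of_mem_insert_of_ne hy hyx⟩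

theorem Abstracts.unfolds {e e' : ExtExp V N} {s : State V} (h : Abstracts Γ P e s)
    (hu : Unfolds Γ e e') (hd : Derives Γ e' s.exp) : Abstracts Γ P e' s :=
  ⟨hu.isSubexp.trans h.isSubexp, hd, h.env⟩

theorem Abstracts.exists_unfolds_app {e : ExtExp V N} {t₁ t₂ : PureExp V} {ρ : Env V}
    {h : (PureExp.app t₁ t₂).fv ⊆ ↑ρ.dom} (ha : Abstracts Γ P e ⟨.app t₁ t₂, ρ, h⟩) :
    ∃ e₁ e₂, Unfolds Γ e (.app e₁ e₂) ∧ Abstracts Γ P (.app e₁ e₂) ⟨.app t₁ t₂, ρ, h⟩ := by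
  obtain ⟨e', hu, hd, hn⟩ := ha.derives.exists_unfolds
  have ha' := ha.unfolds hu hd
  cases e' with
  | var x => exact absurd hd.eq_var nofun
  | nt A => exact absurd rfl (hn A)
  | app e₁ e₂ => exact ⟨e₁, e₂, hu, ha'⟩
  | lam x e =>
    obtain ⟨_, heq, -⟩ := hd.exists_lam
    cases heq

theorem Abstracts.app_left {e₁ e₂ : ExtExp V N} {t₁ t₂ : PureExp V} {ρ : Env V}
    {h : (PureExp.app t₁ t₂).fv ⊆ ↑ρ.dom} (ha : Abstracts Γ P (.app e₁ e₂) ⟨.app t₁ t₂, ρ, h⟩) :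
    Abstracts Γ P e₁ ⟨t₁, ρ, fv_left h⟩ := by
  obtain ⟨_, _, heq, h₁, -⟩ := ha.derives.exists_app
  cases heq
  exact ⟨(IsSubexp.appLeft (.refl _)).trans ha.isSubexp, h₁, ha.env⟩

theorem Abstracts.app_right {e₁ e₂ : ExtExp V N} {t₁ t₂ : PureExp V} {ρ : Env V}
    {h : (PureExp.app t₁ t₂).fv ⊆ ↑ρ.dom} (ha : Abstracts Γ P (.app e₁ e₂) ⟨.app t₁ t₂, ρ, h⟩) :
    Abstracts Γ P e₂ ⟨t₂, ρ, fv_right h⟩ := by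
  obtain ⟨_, _, heq, -, h₂⟩ := ha.derives.exists_app
  cases heq
  exact ⟨(IsSubexp.appRight (.refl _)).trans ha.isSubexp, h₂, ha.env⟩

variable [DecidableEq V]

variable (Γ P) in
/-- The approximate semantics has an evaluation of `e` that safely abstracts `s ⇓ v`. -/
def SimulatesEval (e : ExtExp V N) (s : State V) (v : Value V) : Prop :=
  ∃ w G, AEval Γ P e w G ∧ AbstractsValue Γ P w v ∧
    G.Safe s.nodeWeight v.toState.nodeWeight ∧ G.EndsIn Γ w

variable (Γ P) in
/-- The approximate semantics has a call from `e` that safely abstracts `s → s'`. -/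
def SimulatesCall (k : CallKind) (e : ExtExp V N) (s s' : State V) : Prop :=
  ∃ e' G, ACall Γ P k e e' G ∧ Abstracts Γ P e' s' ∧ G.Safe s.nodeWeight s'.nodeWeight

theorem SimulatesEval.of_unfolds {e e' : ExtExp V N} {s : State V} {v : Value V}
    (hu : Unfolds Γ e e') (h : SimulatesEval Γ P e' s v) : SimulatesEval Γ P e s v := by
  induction hu with
  | refl => exact h
  | @step A e _ hA _ ih =>
    obtain ⟨w, G, hev, hw, hs, hend⟩ := ih h
    exact ⟨w, _, .result (.inr rfl) (.gram hA) hev, hw, (idEq_safe Γ e _).comp hs, hend.comp⟩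

theorem nodeWeight_left_lt {t₁ t₂ : PureExp V} {ρ : Env V}
    (h : (PureExp.app t₁ t₂).fv ⊆ ↑ρ.dom) :
    (⟨t₁, ρ, fv_left h⟩ : State V).nodeWeight .eps <
      (⟨.app t₁ t₂, ρ, h⟩ : State V).nodeWeight .eps := by
  simp only [State.nodeWeight, PureExp.weight]
  lia

theorem nodeWeight_right_lt {t₁ t₂ : PureExp V} {ρ : Env V}
    (h : (PureExp.app t₁ t₂).fv ⊆ ↑ρ.dom) :
    (⟨t₂, ρ, fv_right h⟩ : State V).nodeWeight .eps <
      (⟨.app t₁ t₂, ρ, h⟩ : State V).nodeWeight .eps := by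
  simp only [State.nodeWeight, PureExp.weight]
  lia

theorem nodeWeight_left_var_le {t₁ t₂ : PureExp V} {ρ : Env V}
    (h : (PureExp.app t₁ t₂).fv ⊆ ↑ρ.dom) (y : V) :
    (⟨t₁, ρ, fv_left h⟩ : State V).nodeWeight (.var y) ≤
      (⟨.app t₁ t₂, ρ, h⟩ : State V).nodeWeight (.var y) :=
  State.nodeWeight_var_mono _ _ Set.subset_union_left y

theorem nodeWeight_right_var_le {t₁ t₂ : PureExp V} {ρ : Env V}
    (h : (PureExp.app t₁ t₂).fv ⊆ ↑ρ.dom) (y : V) :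
    (⟨t₂, ρ, fv_right h⟩ : State V).nodeWeight (.var y) ≤
      (⟨.app t₁ t₂, ρ, h⟩ : State V).nodeWeight (.var y) :=
  State.nodeWeight_var_mono _ _ Set.subset_union_right y

theorem SimulatesEval.lam {e : ExtExp V N} {x : V} {t : PureExp V} {ρ : Env V}
    {h : (PureExp.lam x t).fv ⊆ ↑ρ.dom} (ha : Abstracts Γ P e ⟨.lam x t, ρ, h⟩) :
    SimulatesEval Γ P e ⟨.lam x t, ρ, h⟩ (.clo x t ρ.dom ρ.val h) := by
  obtain ⟨e', hu, hd, hn⟩ := ha.derives.exists_unfolds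
  have ha' := ha.unfolds hu hd
  refine .of_unfolds hu ?_
  cases e' with
  | var x => exact absurd hd.eq_var nofun
  | nt A => exact absurd rfl (hn A)
  | app e₁ e₂ =>
    obtain ⟨_, _, heq, -⟩ := hd.exists_app
    cases heq
  | lam x e =>
    obtain ⟨_, heq, hd'⟩ := hd.exists_lam
    cases heq
    choose w hb hw using ha'.env
    exact ⟨_, _, .value x e, .clo ha'.isSubexp hd' w hb hw, idEq_safe Γ _ _, idEq_endsIn Γ _⟩

theorem SimulatesEval.var {e : ExtExp V N} {x : V} {ρ : Env V}
    {h : (PureExp.var x).fv ⊆ ↑ρ.dom} (ha : Abstracts Γ P e ⟨.var x, ρ, h⟩) :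
    SimulatesEval Γ P e ⟨.var x, ρ, h⟩ (ρ.val ⟨x, h rfl⟩) := by
  obtain ⟨e', hu, hd, hn⟩ := ha.derives.exists_unfolds
  refine .of_unfolds hu ?_
  cases e' with
  | var y =>
    cases hd.eq_var
    -- The environment records an application that may bind `x`; its two evaluations are the
    -- premises of the approximate variable rule.
    obtain ⟨w, ⟨e₁, e₂, e₀, G₁, G₂, hsub, h₁, h₂⟩, hw⟩ := ha.env ⟨x, h rfl⟩
    exact ⟨w, _, .var hsub h₁ h₂, hw, varGraph_safe Γ w h, varGraph_endsIn Γ x w⟩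
  | nt A => exact absurd rfl (hn A)
  | app e₁ e₂ =>
    obtain ⟨_, _, heq, -⟩ := hd.exists_app
    cases heq
  | lam x e =>
    obtain ⟨_, heq, -⟩ := hd.exists_lam
    cases heq

theorem SimulatesCall.operator {e₁ e₂ : ExtExp V N} {t₁ t₂ : PureExp V} {ρ : Env V}
    {h : (PureExp.app t₁ t₂).fv ⊆ ↑ρ.dom} (ha : Abstracts Γ P (.app e₁ e₂) ⟨.app t₁ t₂, ρ, h⟩) :
    SimulatesCall Γ P .r (.app e₁ e₂) ⟨.app t₁ t₂, ρ, h⟩ ⟨t₁, ρ, fv_left h⟩ :=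
  ⟨e₁, _, .operator e₁ e₂, ha.app_left,
    idDown_safe Γ e₁ (nodeWeight_left_lt h) (nodeWeight_left_var_le h)⟩

theorem SimulatesCall.operand {e₁ e₂ : ExtExp V N} {t₁ t₂ : PureExp V} {ρ : Env V}
    {h : (PureExp.app t₁ t₂).fv ⊆ ↑ρ.dom} (ha : Abstracts Γ P (.app e₁ e₂) ⟨.app t₁ t₂, ρ, h⟩) :
    SimulatesCall Γ P .d (.app e₁ e₂) ⟨.app t₁ t₂, ρ, h⟩ ⟨t₂, ρ, fv_right h⟩ :=
  ⟨e₂, _, .operand e₁ e₂, ha.app_right,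
    idDown_safe Γ e₂ (nodeWeight_right_lt h) (nodeWeight_right_var_le h)⟩

theorem SimulatesCall.call {e₁ e₂ : ExtExp V N} {t₁ t₂ t₀ : PureExp V} {ρ ρ₀ : Env V} {x : V}
    {h : (PureExp.app t₁ t₂).fv ⊆ ↑ρ.dom} {h₀ : (PureExp.lam x t₀).fv ⊆ ↑ρ₀.dom} {v₂ : Value V}
    (ha : Abstracts Γ P (.app e₁ e₂) ⟨.app t₁ t₂, ρ, h⟩)
    (h₁ : SimulatesEval Γ P e₁ ⟨t₁, ρ, fv_left h⟩ (.clo x t₀ ρ₀.dom ρ₀.val h₀))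
    (h₂ : SimulatesEval Γ P e₂ ⟨t₂, ρ, fv_right h⟩ v₂) :
    SimulatesCall Γ P .c (.app e₁ e₂) ⟨.app t₁ t₂, ρ, h⟩ ⟨t₀, ρ₀.update x v₂, fv_body h₀⟩ := by
  obtain ⟨w₁, G₁, hev₁, hw₁, hs₁, hend₁⟩ := h₁
  obtain ⟨w₂, G₂, hev₂, hw₂, hs₂, -⟩ := h₂
  obtain ⟨e₀, rfl, hsub, hd, henv⟩ := hw₁.exists_lam
  refine ⟨e₀, _, .call hev₁ hev₂, ⟨(IsSubexp.lam (.refl _)).trans hsub, hd, ?_⟩, ?_⟩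
  -- The new binding of `x` is witnessed by the present application itself.
  · exact henv.update ⟨e₁, e₂, e₀, G₁, G₂, ha.isSubexp, hev₁, hev₂⟩ hw₂
  · exact unionRestrict_safe
      (dropEps_safe hd hend₁ hs₁ (nodeWeight_left_lt h) (nodeWeight_left_var_le h))
      (epsTo_safe (h₀ := h₀) hs₂ (nodeWeight_right_lt h) (nodeWeight_right_var_le h))

theorem Eval.simulates {s : State V} {v : Value V} (h : Eval s v) :
    ∀ e : ExtExp V N, Abstracts Γ P e s → SimulatesEval Γ P e s v := by
  -- The motive for calls covers applications only: a nonterminal needs several `n` calls first,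
  -- which the evaluation case prepends.
  refine Eval.rec
    (motive_1 := fun s v _ => ∀ e : ExtExp V N, Abstracts Γ P e s → SimulatesEval Γ P e s v)
    (motive_2 := fun k s s' _ => ∀ e₁ e₂ : ExtExp V N, Abstracts Γ P (.app e₁ e₂) s →
      SimulatesCall Γ P k (.app e₁ e₂) s s') ?_ ?_ ?_ ?_ ?_ ?_ h
  · exact fun _ _ _ _ _ ha => .lam ha
  · exact fun _ _ _ _ ha => .var ha
  · intro t₁ t₂ ρ h s' v _ _ ihc ihe e ha
    obtain ⟨e₁, e₂, hu, ha'⟩ := ha.exists_unfolds_app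
    obtain ⟨e', G', hcall, ha'', hs'⟩ := ihc e₁ e₂ ha'
    obtain ⟨w, G, hev, hw, hs, hend⟩ := ihe e' ha''
    exact .of_unfolds hu
      ⟨w, _, .result (.inl rfl) hcall hev, hw, hs'.comp hs, hend.comp⟩
  · exact fun _ _ _ _ _ _ ha => .operator ha
  · exact fun _ _ _ _ ha => .operand ha
  · exact fun _ _ ih₁ ih₂ e₁ e₂ ha => .call ha (ih₁ e₁ ha.app_left) (ih₂ e₂ ha.app_right)

theorem Call.simulates {k : CallKind} {s s' : State V} (h : Call k s s') (e₁ e₂ : ExtExp V N)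
    (ha : Abstracts Γ P (.app e₁ e₂) s) : SimulatesCall Γ P k (.app e₁ e₂) s s' := by
  cases h with
  | operator => exact .operator ha
  | operand => exact .operand ha
  | call h₁ h₂ =>
    exact .call ha (h₁.simulates e₁ ha.app_left) (h₂.simulates e₂ ha.app_right)

/-- A state with a call is abstracted only by expressions with a call, which either unfolds a
nonterminal or simulates the call. -/
theorem Abstracts.exists_call {e : ExtExp V N} {s s' : State V} {k : CallKind}
    (ha : Abstracts Γ P e s) (hc : Call k s s') :
    ∃ k' e' G, ACall Γ P k' e e' G ∧
      ((Abstracts Γ P e' s ∧ G.Safe s.nodeWeight s.nodeWeight) ∨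
        (Abstracts Γ P e' s' ∧ G.Safe s.nodeWeight s'.nodeWeight)) := by
  obtain ⟨t₁, t₂, ht⟩ : ∃ t₁ t₂, s.exp = .app t₁ t₂ := by
    cases hc <;> exact ⟨_, _, rfl⟩
  cases e with
  | var x => exact absurd (ht.symm.trans ha.derives.eq_var) nofun
  | lam x e =>
    obtain ⟨_, heq, -⟩ := ha.derives.exists_lam
    exact absurd (ht.symm.trans heq) nofun
  | nt A =>
    obtain ⟨e', hA, hd⟩ := ha.derives.exists_production A rfl
    exact ⟨.n, e', _, .gram hA, .inl ⟨ha.unfolds (.step hA (.refl _)) hd, idEq_safe Γ e' _⟩⟩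
  | app e₁ e₂ =>
    obtain ⟨e', G, hcall, h⟩ := hc.simulates e₁ e₂ ha
    exact ⟨k, e', G, hcall, .inr h⟩

theorem exists_approxInfiniteCallSeq {Q : PureExp V} {hQ : Q.Closed} (hd : Derives Γ P Q)
    {s : ℕ → State V} (hs : IsInfiniteCallSeq Q hQ s) :
    ∃ (e : ℕ → ExtExp V N) (G : ℕ → Graph V),
      IsApproxInfiniteCallSeq Γ P e G ∧ ¬ HasInfinitelyDescendingThread G := by
  -- A pair holds the current expression and the index of the exact state it abstracts. An `n` call
  -- leaves the index unchanged. Nothing forces the index to grow: even endless unfolding gives an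
  -- infinite approximate sequence with safe graphs.
  have hstep : ∀ c : {c : ExtExp V N × ℕ // Abstracts Γ P c.1 (s c.2)},
      ∃ (c' : {c : ExtExp V N × ℕ // Abstracts Γ P c.1 (s c.2)}) (G : Graph V),
        (∃ k, ACall Γ P k c.1.1 c'.1.1 G) ∧
          G.Safe (s c.1.2).nodeWeight (s c'.1.2).nodeWeight := by
    rintro ⟨⟨e, i⟩, ha⟩
    obtain ⟨k, hc⟩ := hs.step i
    obtain ⟨k', e', G, hcall, ⟨ha', hG⟩ | ⟨ha', hG⟩⟩ := ha.exists_call hc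
    · exact ⟨⟨(e', i), ha'⟩, G, ⟨k', hcall⟩, hG⟩
    · exact ⟨⟨(e', i + 1), ha'⟩, G, ⟨k', hcall⟩, hG⟩
  choose next G hcall hG using hstep
  have h₀ : Abstracts Γ P P (s 0) := by
    rw [hs.start]
    exact ⟨.refl P, hd, fun y => absurd y.2 (Finset.notMem_empty y.1)⟩
  let c : ℕ → {c : ExtExp V N × ℕ // Abstracts Γ P c.1 (s c.2)} :=
    fun n => next^[n] ⟨(P, 0), h₀⟩
  have hc : ∀ n, c (n + 1) = next (c n) := fun n => Function.iterate_succ_apply' next n _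
  refine ⟨fun n => (c n).1.1, fun n => G (c n), ⟨rfl, fun n => ?_⟩,
    not_hasInfinitelyDescendingThread (f := fun n => (s (c n).1.2).nodeWeight) fun n => ?_⟩
  · rw [hc]
    exact hcall (c n)
  · simp only [hc]
    exact hG (c n)

end Simulation

/-! ## Nontermination and infinite call sequences -/

section Nontermination

variable [DecidableEq V]

/-- Only an application can lack a value. Among operator, operand and called body, in this order,
the first without a value is the target of a call. -/
theorem exists_call_of_not_eval {s : State V} (h : ¬ ∃ v, Eval s v) :
    ∃ s', (∃ k, Call k s s') ∧ ¬ ∃ v, Eval s' v := by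
  obtain ⟨e, ρ, hfv⟩ := s
  cases e with
  | var x => exact absurd ⟨_, .var x ρ hfv⟩ h
  | lam x e => exact absurd ⟨_, .value x e ρ hfv⟩ h
  | app e₁ e₂ =>
    by_cases h₁ : ∃ v, Eval ⟨e₁, ρ, fv_left hfv⟩ v
    · obtain ⟨⟨x, e₀, dom, val, h₀⟩, hv₁⟩ := h₁
      by_cases h₂ : ∃ v, Eval ⟨e₂, ρ, fv_right hfv⟩ v
      · obtain ⟨v₂, hv₂⟩ := h₂
        have hc := Call.call (h := hfv) (ρ₀ := ⟨dom, val⟩) hv₁ hv₂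
        exact ⟨_, ⟨_, hc⟩, fun ⟨v, hv⟩ => h ⟨v, .apply hc hv⟩⟩
      · exact ⟨_, ⟨_, .operand hv₁⟩, h₂⟩
    · exact ⟨_, ⟨_, .operator e₁ e₂ ρ hfv⟩, h₁⟩

theorem exists_infiniteCallSeq {Q : PureExp V} (hQ : Q.Closed)
    (h : ¬ ∃ v, Eval (initState Q hQ) v) : ∃ s, IsInfiniteCallSeq Q hQ s := by
  have hstep : ∀ s : {s : State V // ¬ ∃ v, Eval s v},
      ∃ s' : {s : State V // ¬ ∃ v, Eval s v}, ∃ k, Call k s.1 s'.1 := by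
    rintro ⟨s, hs⟩
    obtain ⟨s', hc, hs'⟩ := exists_call_of_not_eval hs
    exact ⟨⟨s', hs'⟩, hc⟩
  choose next hnext using hstep
  refine ⟨fun n => (next^[n] ⟨_, h⟩).1, rfl, fun n => ?_⟩
  rw [Function.iterate_succ_apply']
  exact hnext _

end Nontermination

end LambdaSCT

theorem mainTheorem4 {V : Type*} [DecidableEq V] {N : Type*} [Finite N]
    (Γ : LambdaSCT.Grammar V N) (P : LambdaSCT.ExtExp V N) (hP : LambdaSCT.ExtClosed Γ P) :
    ((∃ (Q : LambdaSCT.PureExp V) (hQ : Q.Closed), LambdaSCT.Derives Γ P Q ∧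
        ∃ s : ℕ → LambdaSCT.State V, LambdaSCT.IsInfiniteCallSeq Q hQ s) →
      ∃ (e : ℕ → LambdaSCT.ExtExp V N) (G : ℕ → LambdaSCT.Graph V),
        LambdaSCT.IsApproxInfiniteCallSeq Γ P e G ∧
          ¬ LambdaSCT.HasInfinitelyDescendingThread G) ∧
    ((∀ (e : ℕ → LambdaSCT.ExtExp V N) (G : ℕ → LambdaSCT.Graph V),
        LambdaSCT.IsApproxInfiniteCallSeq Γ P e G → LambdaSCT.HasInfinitelyDescendingThread G) →
      LambdaSCT.GammaTerminating Γ P) := by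
  have hinf : ∀ (Q : LambdaSCT.PureExp V) (hQ : Q.Closed), LambdaSCT.Derives Γ P Q →
      ∀ s : ℕ → LambdaSCT.State V, LambdaSCT.IsInfiniteCallSeq Q hQ s →
      ∃ (e : ℕ → LambdaSCT.ExtExp V N) (G : ℕ → LambdaSCT.Graph V),
        LambdaSCT.IsApproxInfiniteCallSeq Γ P e G ∧
          ¬ LambdaSCT.HasInfinitelyDescendingThread G :=
    fun Q hQ hd s hs => LambdaSCT.exists_approxInfiniteCallSeq hd hs
  refine ⟨fun ⟨Q, hQ, hd, s, hs⟩ => hinf Q hQ hd s hs, fun hdesc τ hτ => ?_⟩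
  have hd : LambdaSCT.Derives Γ P (P.subst τ) := .subst P τ hτ
  refine ⟨hP _ hd, ?_⟩
  by_contra hnot
  obtain ⟨s, hs⟩ := LambdaSCT.exists_infiniteCallSeq (hP _ hd) hnot
  obtain ⟨e, G, hseq, hno⟩ := hinf _ _ hd s hs
  exact hno (hdesc e G hseq)
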